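/- Let $\mathbb F_q$ be a finite field with $q$ elements and characteristic $p$, $A=\mathbb F_q[T]$, $k=\mathbb F_q(T)$, $k_\infty=\mathbb F_q((1/T))$ with $|T|=q$, and let ${\bf C}_\infty$ be the completion of an algebraic closure of $k_\infty$. For $x\in k_\infty^\times$ let $\deg x=\log_q|x|$ and let $\mathrm{sgn}(x)\in\mathbb F_q^\times$ be the leading coefficient of $x$ as a Laurent series in $1/T$. Let $f\in k_\infty$ satisfy $f^2=af+b$ with $a\in A$ monic, $b\in\mathbb F_q^\times$ and $|f|>|f^*|$, where $f^*=a-f$; put $d=\deg a$ (so $d\ge 1$). Let $K=k(f)\subset k_\infty$, let $\infty_1$ be the place of $K$ induced by this embedding, let $A_{\infty_1}\subset K$ be the ring of elements regular at every place of $K$ other than $\infty_1$, and for $0\le i\le d-1$ let $\mathfrak a_i=(f,fT,\dots,fT^i)\subset A_{\infty_1}$. Let $\pi\in k_\infty$ be the root of sign $1$ given by $\pi=f^{-1/d}$ if $p\nmid d$ and $\pi=(fT)^{-1/(d+1)}$ if $p\mid d$; for $x\in k_\infty^\times$ put $\langle x\rangle=x\,\pi^{\deg x}/\mathrm{sgn}(x)$.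 For $L\subset k_\infty$ equal to one of the $\mathbb F_q$-spaces $\Lambda_\varepsilon(f)$ (below) or $\mathfrak a_i$, a period of $L$ is an element $\xi\in{\bf C}_\infty$ with $\xi^{q-1}=\eta^{-1}\pi^{-t}u^{q-1}$, where $\eta=\lim_{M\to\infty}\prod_{0\ne\lambda\in L,\ \deg\lambda=M}\mathrm{sgn}(\lambda)$, $u=\lim_{M\to\infty}\prod_{0\ne\lambda\in L,\ \deg\lambda\le M}\langle\lambda\rangle$, and $t=(q-1)Z_L'(1)$ with $Z_L(X)=\sum_{0\ne\lambda\in L}X^{\deg\lambda}$ continued as a rational function of $X$. For $N\ge 0$ and $0\le l\le d-1$ let $\varepsilon=q^{-dN-l}$, $\Lambda_\varepsilon(f)=\{c\in A:\ \mathrm{dist}(cf,A)<\varepsilon\}$, let $\xi_\varepsilon$ be a period of $\Lambda_\varepsilon(f)$, $\breve\Lambda_\varepsilon(f)=\xi_\varepsilon\Lambda_\varepsilon(f)\subset{\bf C}_\infty$, and $\delta=q^{-dN}\varepsilon\,|\xi_{d-1-l}|$, where $\xi_{d-1-l}$ is a period of $\mathfrak a_{d-1-l}$. Let $0\ne\alpha\in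 A_{\infty_1}$, let $\varepsilon$ be so small that $\delta<|\alpha|^{-1}$, and put $$\tilde\Lambda_{\varepsilon,\alpha}(f)=\{x\in\alpha^{-1}\breve\Lambda_\varepsilon(f):\ \mathrm{dist}(x,\breve\Lambda_\varepsilon(f))<\delta\}.$$ For $L\subset{\bf C}_\infty$ write $\exp_L(z)=z\prod_{0\ne\lambda\in L}(1-z/\lambda)$, and let $e_\varepsilon=\exp_{\breve\Lambda_\varepsilon(f)}$. Then $\alpha^{-1}\breve\Lambda_\varepsilon(f)$ and $\tilde\Lambda_{\varepsilon,\alpha}(f)$ are $\mathbb F_q$-subspaces of ${\bf C}_\infty$, the quotient $\alpha^{-1}\breve\Lambda_\varepsilon(f)/\tilde\Lambda_{\varepsilon,\alpha}(f)$ is finite-dimensional over $\mathbb F_q$, and the products defining $e_\varepsilon(z)$ and $\exp_{\tilde\Lambda_{\varepsilon,\alpha}(f)}(z)$ converge unconditionally for all $z\in{\bf C}_\infty$. For every system $R$ of representatives of the nonzero classes of $\alpha^{-1}\breve\Lambda_\varepsilon(f)$ modulo $\tilde\Lambda_{\varepsilon,\alpha}(f)$ (such systems exist and are finite) one has $\exp_{\tilde\Lambda_{\varepsilon,\alpha}(f)}(\lambda)\ne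 0$ for $\lambda\in R$, and for all $z\in{\bf C}_\infty$ $$e_\varepsilon(\alpha z)=\alpha\,\exp_{\tilde\Lambda_{\varepsilon,\alpha}(f)}(z)\prod_{\lambda\in R}\left(1-\frac{\exp_{\tilde\Lambda_{\varepsilon,\alpha}(f)}(z)}{\exp_{\tilde\Lambda_{\varepsilon,\alpha}(f)}(\lambda)}\right).$$ Moreover the polynomial $$\rho_{\varepsilon,\alpha}(w)=\alpha w\prod_{\lambda\in R}\left(1-\frac{w}{\exp_{\tilde\Lambda_{\varepsilon,\alpha}(f)}(\lambda)}\right)\in{\bf C}_\infty[w]$$ does not depend on $R$, is additive, $\rho_{\varepsilon,\alpha}(x+y)=\rho_{\varepsilon,\alpha}(x)+\rho_{\varepsilon,\alpha}(y)$, and satisfies $e_\varepsilon(\alpha z)=\rho_{\varepsilon,\alpha}(\exp_{\tilde\Lambda_{\varepsilon,\alpha}(f)}(z))$ for all $z$. -/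

import Mathlib

open Polynomial Filter Topology

noncomputable section

namespace QuantumDrinfeld

/-! ### The local field `k_∞ = 𝔽_q((1/T))` and the field `C_∞` -/

section Fields

variable (F : Type*) [Field F] [Fintype F]

/-- The completion `k_∞` of `k = F(T)` at `∞`, i.e. the field of Laurent series over the finite
field `F` in the variable `1/T`. -/
abbrev KInf : Type _ := LaurentSeries F

/-- The absolute value on `k_∞` takes values in `q ^ ℤ`, with `q = #F`. -/
instance rankOne : (Valued.v (R := KInf F) (Γ₀ := WithZero (Multiplicative ℤ))).RankOne where
  hom' := (WithZeroMulInt.toNNReal (e := (Fintype.card F : NNReal))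
      (by exact_mod_cast Fintype.card_ne_zero)).comp MonoidWithZeroHom.ValueGroup₀.embedding
  strictMono' := (WithZeroMulInt.toNNReal_strictMono
      (by exact_mod_cast Fintype.one_lt_card)).comp
        MonoidWithZeroHom.ValueGroup₀.embedding_strictMono
  exists_val_nontrivial := by
    refine ⟨HahnSeries.single 1 1, ?_, ?_⟩
    · simp
    · rw [LaurentSeries.valuation_single_zpow]
      simp

instance kInfNormed : NontriviallyNormedField (KInf F) := 
  Valued.toNontriviallyNormedField (KInf F) (WithZero (Multiplicative ℤ))

instance kInfUltra : IsUltrametricDist (KInf F) :=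
  inferInstanceAs (@IsUltrametricDist (KInf F)
    (Valued.toNormedField (KInf F) (WithZero (Multiplicative ℤ))).toDist)

/-- The element `T` of `k_∞`. -/
def T : KInf F := HahnSeries.single (-1) 1

/-- An algebraic closure of `k_∞`. -/
abbrev KInfBar : Type _ := AlgebraicClosure (KInf F)

instance kInfBarNormed : NormedField (KInfBar F) := spectralNorm.normedField (KInf F) (KInfBar F)

instance kInfBarAlg : NormedAlgebra (KInf F) (KInfBar F) := spectralNorm.normedAlgebra _ _

/-- The completion `C_∞` of the algebraic closure of `k_∞`. -/
abbrev CInf : Type _ := UniformSpace.Completion (KInfBar F)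

instance cInfAlg : NormedAlgebra (KInf F) (CInf F) := inferInstance

instance kInfBarConstSMul : UniformContinuousConstSMul F (KInfBar F) where
  uniformContinuous_const_smul c := by
    have h : (fun x : KInfBar F => c • x) = fun x => algebraMap F (KInfBar F) c * x := by
      funext x
      exact Algebra.smul_def c x
    change UniformContinuous (fun x : KInfBar F => c • x)
    rw [h]
    exact uniformContinuous_const_smul (algebraMap F (KInfBar F) c)

instance cInfAlgF : Algebra F (CInf F) := inferInstance

/-- The absolute value is normalized by `|T| = q`. -/
theorem norm_T : ‖T F‖ = Fintype.card F := by
  rw [Valued.toNormedField.norm_def]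
  simp [T, Valuation.RankOne.hom, Valuation.RankLeOne.hom', Valuation.restrict_def,
    LaurentSeries.valuation_single_zpow]
  rw [WithZeroMulInt.toNNReal_neg_apply _ (by simp)]
  simp [WithZero.exp]

end Fields

section Lattices

variable {F : Type*} [Field F] [Fintype F]

/-! ### `A`, signs, degrees, and the quadratic unit `f` -/

/-- The inclusion of `A = F[T]` in `k_∞`. -/
def polyEmb : F[X] →ₐ[F] KInf F := Polynomial.aeval (T F)

/-- The sign of `x ∈ k_∞`: the coefficient of its leading term as a Laurent series in `1/T`. -/
def sgn (x : KInf F) : F := x.leadingCoeff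

/-- The degree in `T` of a (nonzero) element of `k_∞`. -/
def degT (x : KInf F) : ℤ := -x.order

/-- `f ∈ k_∞` is a root of `X² - aX - b`, where `a ∈ A` is monic and `b ∈ F` is nonzero, and it is
larger in absolute value than its conjugate `a - f`. -/
structure IsQuadraticUnit (a : F[X]) (b : F) (f : KInf F) : Prop where
  monic : a.Monic
  ne_zero : b ≠ 0
  root : f ^ 2 = polyEmb a * f + algebraMap F (KInf F) b
  conj_lt : ‖polyEmb a - f‖ < ‖f‖

/-- `π = f^(-1/d)` if `d` is prime to the characteristic `p`, and `π = (fT)^(-1/(d+1))` otherwise;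
of the possible roots in `k_∞`, it is the one of sign `1`. -/
def IsUniformizer (f : KInf F) (d : ℕ) (π : KInf F) : Prop :=
  sgn π = 1 ∧
    if d.Coprime (ringChar F) then π ^ d = f⁻¹ else π ^ (d + 1) = (f * T F)⁻¹

/-- `Λ_ε(f) = {a ∈ A : ‖a f‖ < ε}`, where `‖x‖` is the distance of `x` to `A`. -/
def Lam (f : KInf F) (ε : ℝ) : Set (KInf F) :=
  {x | x ∈ Set.range (polyEmb (F := F)) ∧
    Metric.infDist (x * f) (Set.range (polyEmb (F := F))) < ε}

/-! ### The ring `A_{∞₁}` and its ideals `𝔞_i` -/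

/-- The field `K = k(f)`, as a subfield of `k_∞`. -/
def quadField (f : KInf F) : IntermediateField F (KInf F) :=
  IntermediateField.adjoin F {T F, f}

/-- The valuation ring in `K` of the place `∞₁`, which is the one induced by `K ⊆ k_∞`. -/
def placeInf1 (f : KInf F) : ValuationSubring (quadField f) :=
  (NormedField.valuation (K := KInf F)).valuationSubring.comap (quadField f).val.toRingHom

/-- The ring `A_{∞₁} ⊆ K ⊆ k_∞` of the elements of `K` that are regular at every place of `K`
other than `∞₁`. -/
def AInf1 (f : KInf F) : Subring (KInf F) :=
  (⨅ V : {V : ValuationSubring (quadField f) // V ≠ placeInf1 f}, V.1.toSubring).map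
    (quadField f).val.toRingHom

/-- The ideal `𝔞_i = (f, fT, …, fT^i)` of `A_{∞₁}`. -/
def idealA (f : KInf F) (i : ℕ) : Set (KInf F) :=
  (Submodule.span (AInf1 f) {x : KInf F | ∃ j ≤ i, x = f * T F ^ j} : Submodule (AInf1 f) (KInf F))

/-! ### Periods -/

/-- `η = lim_{M → ∞} ∏_{0 ≠ x ∈ L, deg x = M} sgn x` (a limit in the discrete set `F`). -/
def IsSignLimit (L : Set (KInf F)) (η : F) : Prop :=
  ∀ᶠ M : ℕ in atTop, ∏ᶠ x ∈ {x | x ∈ L ∧ x ≠ 0 ∧ degT x = M}, sgn x = η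

/-- The norm zeta function `Z_L(u) = ∑_{0 ≠ x ∈ L} u ^ deg x`, as a power series in `u`. -/
def normZeta (L : Set (KInf F)) : PowerSeries ℂ :=
  PowerSeries.mk fun m => (({x | x ∈ L ∧ x ≠ 0 ∧ degT x = m} : Set (KInf F)).ncard : ℂ)

/-- `t = (q - 1) Z_L'(1)`, where `Z_L` is continued to `u = 1` as a rational function `P/Q`. -/
def IsZetaExponent (L : Set (KInf F)) (t : ℤ) : Prop :=
  ∃ P Q : ℂ[X], Q.eval 1 ≠ 0 ∧ (Q : PowerSeries ℂ) * normZeta L = (P : PowerSeries ℂ) ∧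
    (t : ℂ) = ((Fintype.card F : ℂ) - 1) * deriv (fun u : ℂ => P.eval u / Q.eval u) 1

/-- The `1`-unit part `⟨x⟩ = x π^(deg x) / sgn x` of `x`. -/
def oneUnit (π x : KInf F) : KInf F := x * π ^ degT x / algebraMap F (KInf F) (sgn x)

/-- `u = lim_{M → ∞} ∏_{0 ≠ x ∈ L, deg x ≤ M} ⟨x⟩`. -/
def IsUnitLimit (π : KInf F) (L : Set (KInf F)) (u : KInf F) : Prop :=
  Tendsto (fun M : ℕ => ∏ᶠ x ∈ {x | x ∈ L ∧ x ≠ 0 ∧ degT x ≤ M}, oneUnit π x) atTop (𝓝 u)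

/-- `ξ ∈ C_∞` is a period of `L ⊆ k_∞`, that is `ξ^(q-1) = η⁻¹ π^(-t) u^(q-1)`. This determines
`ξ` up to multiplication by `(q-1)`-th roots of unity. -/
def IsPeriod (π : KInf F) (L : Set (KInf F)) (ξ : CInf F) : Prop :=
  ∃ (η : F) (t : ℤ) (u : KInf F), IsSignLimit L η ∧ IsZetaExponent L t ∧ IsUnitLimit π L u ∧
    ξ ^ (Fintype.card F - 1) = algebraMap (KInf F) (CInf F)
      ((algebraMap F (KInf F) η)⁻¹ * π ^ (-t) * u ^ (Fintype.card F - 1))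

/-! ### Normalized spaces and exponentials -/

/-- The factors `1 - z/x`, `0 ≠ x ∈ L`, of the exponential function of `L`. -/
def expFactor (L : Set (CInf F)) (z : CInf F) (x : {x : CInf F // x ∈ L ∧ x ≠ 0}) : CInf F :=
  1 - z / x

/-- The exponential function `exp_L(z) = z ∏_{0 ≠ x ∈ L} (1 - z/x)`. -/
def latticeExp (L : Set (CInf F)) (z : CInf F) : CInf F := z * ∏' x, expFactor L z x

/-- `ε_{N,l} = q^(-dN-l)`. -/
def epsNl (F : Type*) [Fintype F] (d N l : ℕ) : ℝ := ((Fintype.card F : ℝ) ^ (d * N + l))⁻¹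

/-- `Λ̆_ε(f) = ξ Λ_ε(f)`, for a period `ξ = ξ_ε` of `Λ_ε(f)`. -/
def breveLam (f : KInf F) (ε : ℝ) (ξ : CInf F) : Set (CInf F) :=
  {x | ∃ y ∈ Lam f ε, x = ξ * algebraMap (KInf F) (CInf F) y}

/-- `α⁻¹ Λ̆`. -/
def invMul (α : KInf F) (L : Set (CInf F)) : Set (CInf F) :=
  {x | ∃ y ∈ L, x = (algebraMap (KInf F) (CInf F) α)⁻¹ * y}

/-- `Λ̃ = {x ∈ α⁻¹ Λ̆ : dist(x, Λ̆) < δ}`. -/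
def tildeLam (α : KInf F) (L : Set (CInf F)) (δ : ℝ) : Set (CInf F) :=
  {x | x ∈ invMul α L ∧ Metric.infDist x L < δ}

/-- `R` is a system of representatives of the nonzero classes of `V` modulo `W`. -/
def IsNonzeroReps (V W : Submodule F (CInf F)) (R : Finset (CInf F)) : Prop :=
  (∀ r ∈ R, r ∈ V ∧ r ∉ W) ∧ ∀ x ∈ V, x ∉ W → ∃! r, r ∈ R ∧ x - r ∈ W

/-- The polynomial `α w ∏_{r ∈ R} (1 - w / exp_W(r))` in the variable `w`. -/
def rhoPoly (α : KInf F) (W : Set (CInf F)) (R : Finset (CInf F)) : (CInf F)[X] :=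
  C (algebraMap (KInf F) (CInf F) α) * X * ∏ r ∈ R, (1 - C (latticeExp W r)⁻¹ * X)

end Lattices

end QuantumDrinfeld

end

/-! Write V = α⁻¹Λ̆ and W = Λ̃ ⊆ V. The product exp_V converges because V is a nonzero multiple of a
subspace of A, so each ball contains finitely many of its points; in a complete ultrametric field a
product converges unconditionally once its factors tend to 1. This uses that periods do not vanish
(`IsPeriod.ne_zero`), which also gives δ > 0.

Rescaling gives e_ε(αz) = α exp_V(z) (`setExp_mul_left`). It remains to compare exp_V with exp_W.
The points of W in a ball form a finite group, because the norm is ultrametric. For a finite group S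
the polynomial ∏_{w ∈ S} (z - w) is additive, so the product over a coset r + S is 1 -
exp_S(z)/exp_S(r) (`prod_coset`). Exhausting V by finite unions of such cosets and passing to the
limit gives the factorization (`setExp_of_finiteIndex`).

The index of W in V is finite because k_∞/A is compact: finitely many fractional coefficients of
α⁻¹y and α⁻¹yf decide whether α⁻¹y lies near Λ_ε(f) (`exists_lam_near`, `finite_quotient`).

Finally, exp_W is additive with kernel W, so the roots of ρ form the finite group exp_W(V). Hence ρ
is independent of R, and the additivity of finite-group products applies once more. -/

noncomputable section

namespace QuantumDrinfeld


/-! ### Products over finite additive subgroups of a field -/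

section FiniteGroups

variable {C : Type*} [Field C]

/-- `∏_{w ∈ S} (z - w)` is additive in `z` if `S` is a finite additive subgroup. -/
theorem prod_sub_add (S : Finset C) (h0 : 0 ∈ S) (hadd : ∀ x ∈ S, ∀ y ∈ S, x + y ∈ S)
    (hneg : ∀ x ∈ S, -x ∈ S) (x y : C) :
    ∏ w ∈ S, (x + y - w) = ∏ w ∈ S, (x - w) + ∏ w ∈ S, (y - w) := by
  classical
  set P : C[X] := ∏ w ∈ S, (X - Polynomial.C w) with hP
  have heval : ∀ z, P.eval z = ∏ w ∈ S, (z - w) := fun z => by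
    simp [hP, eval_prod]
  have hPm : P.Monic := monic_prod_of_monic _ _ fun w _ => monic_X_sub_C w
  have hdeg : P.natDegree = S.card := by
    rw [hP, natDegree_prod_of_monic _ _ fun w _ => monic_X_sub_C w]
    simp
  have hpos : 0 < S.card := Finset.card_pos.2 ⟨0, h0⟩
  set P' : C[X] := P.comp (X + Polynomial.C y) with hP'
  have hP'm : P'.Monic := hPm.comp_X_add_C y
  have hdeg' : P'.natDegree = S.card := by
    rw [hP', natDegree_comp, natDegree_X_add_C, mul_one, hdeg]
  have hlt : (P' - P).natDegree < S.card := by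
    have hd : P'.degree = P.degree := by
      rw [degree_eq_natDegree hP'm.ne_zero, degree_eq_natDegree hPm.ne_zero, hdeg, hdeg']
    have := degree_sub_lt_left hd hP'm.ne_zero (by rw [hP'm, hPm])
    by_cases h : P' - P = 0
    · rw [h]; simpa using hpos
    · rw [← hdeg']
      exact natDegree_lt_natDegree h this
  have hroot : ∀ w ∈ S, P.eval w = 0 := fun w hw => by
    rw [heval]
    exact Finset.prod_eq_zero hw (sub_self w)
  -- The leading terms of P(X + y) and P(X) cancel, so this polynomial has degree less than #S. It
  -- vanishes at every w in S, because translation by w permutes S and hence P(w + y) = P(y).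
  have hzero : P' - P - Polynomial.C (P.eval y) = 0 := by
    refine eq_zero_of_natDegree_lt_card_of_eval_eq_zero' _ S (fun w hw => ?_) ?_
    · have : P'.eval w = P.eval y := by
        rw [hP', eval_comp, heval, heval]
        simp only [eval_add, eval_X, eval_C]
        refine Finset.prod_bij' (fun v _ => v - w) (fun v _ => v + w) ?_ ?_ ?_ ?_ ?_
        · intro v hv
          rw [sub_eq_add_neg]
          exact hadd _ hv _ (hneg _ hw)
        · intro v hv
          exact hadd _ hv _ hw
        · intro v _; ring
        · intro v _; ring
        · intro v _; ring
      simp [this, hroot w hw]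
    · refine lt_of_le_of_lt (natDegree_sub_le _ _) ?_
      simpa using max_lt hlt hpos
  have := congrArg (eval x) hzero
  simp only [eval_sub, eval_C, eval_zero, hP', eval_comp, eval_add, eval_X] at this
  rw [← heval, ← heval, ← heval]
  linear_combination this

/-- The exponential function of a finite set. -/
def finExp [DecidableEq C] (S : Finset C) (z : C) : C := z * ∏ w ∈ S.erase 0, (1 - z / w)

theorem finExp_eq [DecidableEq C] (S : Finset C) (h0 : 0 ∈ S) (z : C) :
    finExp S z = (∏ w ∈ S, (z - w)) / ∏ w ∈ S.erase 0, (-w) := by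
  rw [finExp, ← Finset.mul_prod_erase S _ h0, mul_div_assoc, sub_zero, ← Finset.prod_div_distrib]
  congr 1
  refine Finset.prod_congr rfl fun w hw => ?_
  have : w ≠ 0 := Finset.ne_of_mem_erase hw
  field_simp
  ring

theorem finExp_add [DecidableEq C] (S : Finset C) (h0 : 0 ∈ S)
    (hadd : ∀ x ∈ S, ∀ y ∈ S, x + y ∈ S) (hneg : ∀ x ∈ S, -x ∈ S) (x y : C) :
    finExp S (x + y) = finExp S x + finExp S y := by
  rw [finExp_eq S h0, finExp_eq S h0, finExp_eq S h0, prod_sub_add S h0 hadd hneg, add_div]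

theorem finExp_eq_zero [DecidableEq C] (S : Finset C) (h0 : 0 ∈ S) {z : C} (hz : z ∈ S) :
    finExp S z = 0 := by
  rw [finExp_eq S h0, Finset.prod_eq_zero hz (sub_self z), zero_div]

/-- The product over a nonzero coset of a finite additive subgroup. -/
theorem prod_coset [DecidableEq C] (S : Finset C) (h0 : 0 ∈ S)
    (hadd : ∀ x ∈ S, ∀ y ∈ S, x + y ∈ S) (hneg : ∀ x ∈ S, -x ∈ S) {r : C} (hr : r ∉ S) (z : C) :
    ∏ w ∈ S, (1 - z / (r + w)) = 1 - finExp S z / finExp S r := by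
  have hne : ∏ w ∈ S.erase 0, (-w) ≠ 0 :=
    Finset.prod_ne_zero_iff.2 fun w hw => neg_ne_zero.2 (Finset.ne_of_mem_erase hw)
  have hsub : ∀ w ∈ S, r - w ≠ 0 := fun w hw h => hr (by rwa [sub_eq_zero.1 h])
  have hPr : ∏ w ∈ S, (r - w) ≠ 0 := Finset.prod_ne_zero_iff.2 hsub
  -- Additivity applied to r = (r - z) + z.
  have h1 : ∏ w ∈ S, (r - z - w) = ∏ w ∈ S, (r - w) - ∏ w ∈ S, (z - w) := by
    have := prod_sub_add S h0 hadd hneg (r - z) z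
    rw [sub_add_cancel] at this
    linear_combination -this
  have h2 : ∏ w ∈ S, (1 - z / (r + w)) = ∏ w ∈ S, ((r - z - w) / (r - w)) := by
    refine Finset.prod_bij' (fun v _ => -v) (fun v _ => -v) hneg hneg (by simp) (by simp) ?_
    intro w hw
    have : r + w ≠ 0 := by simpa using hsub _ (hneg _ hw)
    rw [sub_neg_eq_add, sub_neg_eq_add]
    field_simp
    ring
  rw [h2, Finset.prod_div_distrib, h1, finExp_eq S h0, finExp_eq S h0, div_div_div_cancel_right₀ hne,
    sub_div, div_self hPr]

end FiniteGroups

/-! ### Infinite products in complete ultrametric fields -/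

section InfiniteProducts

variable {C : Type*} [NormedField C] [IsUltrametricDist C]

theorem norm_prod_sub_one_le {ι : Type*} (f : ι → C) {r : ℝ} (hr0 : 0 ≤ r) (hr : r ≤ 1)
    (s : Finset ι) (h : ∀ i ∈ s, ‖f i - 1‖ ≤ r) : ‖∏ i ∈ s, f i - 1‖ ≤ r := by
  classical
  induction s using Finset.induction_on with
  | empty => simpa using hr0
  | insert i s hi ih =>
    have ih := ih fun j hj => h j (Finset.mem_insert_of_mem hj)
    have h1 := h i (Finset.mem_insert_self i s)
    have hf : ‖f i‖ ≤ 1 := by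
      have := IsUltrametricDist.norm_add_le_max (f i - 1) 1
      rw [sub_add_cancel, norm_one] at this
      exact this.trans (max_le (h1.trans hr) le_rfl)
    rw [Finset.prod_insert hi,
      show f i * ∏ j ∈ s, f j - 1 = f i * (∏ j ∈ s, f j - 1) + (f i - 1) by ring]
    refine (IsUltrametricDist.norm_add_le_max _ _).trans (max_le ?_ h1)
    rw [norm_mul]
    exact (mul_le_of_le_one_left (norm_nonneg _) hf).trans ih

/-- Outside the finitely many factors farther than r from 1, any finite product is within r of 1.
Stating the error relative to the partial product serves both convergence and nonvanishing of the
limit. -/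
theorem exists_finset_norm_prod_sub_le {ι : Type*} {f : ι → C} (hf : Tendsto f cofinite (𝓝 1))
    {r : ℝ} (hr0 : 0 < r) (hr : r ≤ 1) :
    ∃ s₀ : Finset ι, ∀ s t, s₀ ⊆ s → s ⊆ t →
      ‖∏ i ∈ t, f i - ∏ i ∈ s, f i‖ ≤ ‖∏ i ∈ s, f i‖ * r := by
  classical
  have hfin : {i | ¬ ‖f i - 1‖ ≤ r}.Finite := by
    have := hf.eventually (Metric.closedBall_mem_nhds (1 : C) hr0)
    simpa [Filter.Eventually, mem_cofinite, Set.compl_ofPred, dist_eq_norm] using this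
  refine ⟨hfin.toFinset, fun s t hs hst => ?_⟩
  have h := norm_prod_sub_one_le f hr0.le hr (t \ s) fun i hi => by
    by_contra hc
    exact (Finset.mem_sdiff.1 hi).2 (hs (hfin.mem_toFinset.2 hc))
  rw [← Finset.prod_sdiff hst,
    show (∏ i ∈ t \ s, f i) * ∏ i ∈ s, f i - ∏ i ∈ s, f i
      = (∏ i ∈ s, f i) * (∏ i ∈ t \ s, f i - 1) by ring, norm_mul]
  exact mul_le_mul_of_nonneg_left h (norm_nonneg _)

theorem multipliable_of_tendsto_cofinite [CompleteSpace C] {ι : Type*} {f : ι → C}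
    (hf : Tendsto f cofinite (𝓝 1)) : Multipliable f := by
  classical
  obtain ⟨s₁, h₁⟩ := exists_finset_norm_prod_sub_le hf one_pos le_rfl
  set B := ‖∏ i ∈ s₁, f i‖ with hB
  have hbound : ∀ s, s₁ ⊆ s → ‖∏ i ∈ s, f i‖ ≤ B := fun s hs => by
    have h := h₁ s₁ s subset_rfl hs
    rw [mul_one] at h
    have := IsUltrametricDist.norm_add_le_max (∏ i ∈ s, f i - ∏ i ∈ s₁, f i) (∏ i ∈ s₁, f i)
    rw [sub_add_cancel] at this
    exact this.trans (max_le h le_rfl)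
  have hB0 : 0 ≤ B := norm_nonneg _
  have hc : CauchySeq fun s : Finset ι => ∏ i ∈ s, f i := by
    refine Metric.cauchySeq_iff'.2 fun e he => ?_
    -- Partial products beyond s₁ have norm at most B, so relative error e/(B + 1) means absolute
    -- error below e. The summand 1 covers B = 0.
    obtain ⟨s₀, h₀⟩ := exists_finset_norm_prod_sub_le hf (r := min 1 (e / (B + 1)))
      (lt_min one_pos (by positivity)) (min_le_left _ _)
    refine ⟨s₀ ∪ s₁, fun s hs => ?_⟩
    rw [dist_eq_norm]
    refine (h₀ _ s Finset.subset_union_left hs).trans_lt ?_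
    calc ‖∏ i ∈ s₀ ∪ s₁, f i‖ * min 1 (e / (B + 1)) ≤ B * (e / (B + 1)) := by
          gcongr
          · exact hbound _ Finset.subset_union_right
          · exact min_le_right _ _
      _ < e := by
          rw [← mul_div_assoc, div_lt_iff₀ (by positivity)]
          nlinarith
  obtain ⟨x, hx⟩ := cauchySeq_tendsto_of_complete hc
  exact ⟨x, by simpa [HasProd] using hx⟩

/-- Some nonzero partial product differs from the limit by at most half its own norm. This is what
makes the zeros of the exponential exactly the lattice points. -/
theorem tprod_ne_zero_of_tendsto_cofinite [CompleteSpace C] {ι : Type*} {f : ι → C}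
    (hf : Tendsto f cofinite (𝓝 1)) (h0 : ∀ i, f i ≠ 0) : ∏' i, f i ≠ 0 := by
  classical
  obtain ⟨s₁, h₁⟩ := exists_finset_norm_prod_sub_le hf (r := 1 / 2) (by norm_num) (by norm_num)
  have hlim : Tendsto (fun s : Finset ι => ∏ i ∈ s, f i) atTop (𝓝 (∏' i, f i)) := by
    simpa [HasProd] using (multipliable_of_tendsto_cofinite hf).hasProd
  have hle : ‖∏' i, f i - ∏ i ∈ s₁, f i‖ ≤ ‖∏ i ∈ s₁, f i‖ * (1 / 2) :=
    le_of_tendsto (hlim.sub_const _).norm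
      ((eventually_ge_atTop s₁).mono fun s hs => h₁ s₁ s subset_rfl hs)
  have hpos : 0 < ‖∏ i ∈ s₁, f i‖ := norm_pos_iff.2 (Finset.prod_ne_zero_iff.2 fun i _ => h0 i)
  intro h
  rw [h, zero_sub, norm_neg] at hle
  linarith

end InfiniteProducts

/-! ### Exponential functions of discrete additive subgroups -/

section Exponential

variable {C : Type*} [NormedField C]

/-- `z ∏_{0 ≠ x ∈ L} (1 - z/x)`. -/
def setExp (L : Set C) (z : C) : C := z * ∏' x : {x : C // x ∈ L ∧ x ≠ 0}, (1 - z / (x : C))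

/-- `L` has finitely many elements in each ball. -/
def FiniteBalls (L : Set C) : Prop := ∀ r : ℝ, {x | x ∈ L ∧ ‖x‖ ≤ r}.Finite

theorem FiniteBalls.mono {L L' : Set C} (h : FiniteBalls L) (hL : L' ⊆ L) : FiniteBalls L' :=
  fun r => (h r).subset fun _ hx => ⟨hL hx.1, hx.2⟩

theorem FiniteBalls.tendsto {L : Set C} (h : FiniteBalls L) (z : C) :
    Tendsto (fun x : {x : C // x ∈ L ∧ x ≠ 0} => 1 - z / (x : C)) cofinite (𝓝 1) := by
  have hnorm : Tendsto (fun x : {x : C // x ∈ L ∧ x ≠ 0} => ‖(x : C)‖) cofinite atTop := by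
    refine tendsto_atTop.2 fun r => ?_
    have : {x : {x : C // x ∈ L ∧ x ≠ 0} | ‖(x : C)‖ ≤ r}.Finite :=
      Set.Finite.of_finite_image ((h r).subset (by
        rintro _ ⟨x, hx, rfl⟩
        exact ⟨x.2.1, hx⟩)) Subtype.val_injective.injOn
    refine mem_cofinite.2 (this.subset fun x hx => ?_)
    simp only [Set.mem_compl_iff, Set.mem_ofPred_eq, not_le] at hx ⊢
    exact hx.le
  have : Tendsto (fun x : {x : C // x ∈ L ∧ x ≠ 0} => z / (x : C)) cofinite (𝓝 0) := by
    rw [tendsto_zero_iff_norm_tendsto_zero]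
    simp only [norm_div]
    exact hnorm.const_div_atTop _
  simpa using tendsto_const_nhds.sub this

/-- Multiplication by c carries c⁻¹L onto L and leaves the ratios z/x unchanged. Reindexing along a
bijection needs no convergence. -/
theorem setExp_mul_left (L : Set C) {c : C} (hc : c ≠ 0) (z : C) :
    setExp L (c * z) = c * setExp {x | ∃ y ∈ L, x = c⁻¹ * y} z := by
  let e : {x : C // x ∈ {x | ∃ y ∈ L, x = c⁻¹ * y} ∧ x ≠ 0} ≃ {x : C // x ∈ L ∧ x ≠ 0} :=
    { toFun := fun x => ⟨c * x, by
        obtain ⟨⟨y, hy, h⟩, h0⟩ := x.2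
        rw [h, mul_inv_cancel_left₀ hc]
        exact ⟨hy, fun hy0 => h0 (by rw [h, hy0, mul_zero])⟩⟩
      invFun := fun x => ⟨c⁻¹ * x, ⟨x, x.2.1, rfl⟩, mul_ne_zero (inv_ne_zero hc) x.2.2⟩
      left_inv := fun x => by ext; simp [hc]
      right_inv := fun x => by ext; simp [hc] }
  rw [setExp, setExp, mul_assoc, ← e.tprod_eq]
  congr 2
  refine tprod_congr fun x => ?_
  rw [show ((e x : {x : C // x ∈ L ∧ x ≠ 0}) : C) = c * x from rfl, mul_div_mul_left _ _ hc]

open Classical in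
/-- The elements of norm at most `n` of a discrete set. -/
def FiniteBalls.ball {L : Set C} (h : FiniteBalls L) (n : ℕ) : Finset C := (h n).toFinset

theorem FiniteBalls.mem_ball {L : Set C} (h : FiniteBalls L) {n : ℕ} {x : C} :
    x ∈ h.ball n ↔ x ∈ L ∧ ‖x‖ ≤ n := by
  simp [FiniteBalls.ball]

theorem FiniteBalls.eventually_mem_ball {L : Set C} (h : FiniteBalls L) {x : C} (hx : x ∈ L) :
    ∀ᶠ n in atTop, x ∈ h.ball n := by
  obtain ⟨m, hm⟩ := exists_nat_ge ‖x‖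
  filter_upwards [eventually_ge_atTop m] with n hn
  exact h.mem_ball.2 ⟨hx, hm.trans (by exact_mod_cast hn)⟩

variable [IsUltrametricDist C] [CompleteSpace C]

theorem FiniteBalls.multipliable {L : Set C} (h : FiniteBalls L) (z : C) :
    Multipliable (fun x : {x : C // x ∈ L ∧ x ≠ 0} => 1 - z / (x : C)) :=
  multipliable_of_tendsto_cofinite (h.tendsto z)

theorem setExp_ne_zero {L : Set C} (h : FiniteBalls L) {z : C} (h0 : z ≠ 0) (hz : z ∉ L) :
    setExp L z ≠ 0 := by
  refine mul_ne_zero h0 (tprod_ne_zero_of_tendsto_cofinite (h.tendsto z) fun x hx => hz ?_)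
  have : z = x := by
    have hx0 := x.2.2
    rwa [sub_eq_zero, eq_comm, div_eq_one_iff_eq hx0] at hx
  rw [this]
  exact x.2.1

/-- Unconditional convergence allows the finite sets to be chosen to suit the algebra: balls, which
are groups, or unions of cosets of balls. -/
theorem tendsto_prod_exhaustion {L : Set C} (h : FiniteBalls L) (z : C) (s : ℕ → Finset C)
    (hs : ∀ n, ∀ x ∈ s n, x ∈ L ∧ x ≠ 0) (hex : ∀ x ∈ L, x ≠ 0 → ∀ᶠ n in atTop, x ∈ s n) :
    Tendsto (fun n => ∏ x ∈ s n, (1 - z / x)) atTop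
      (𝓝 (∏' x : {x : C // x ∈ L ∧ x ≠ 0}, (1 - z / (x : C)))) := by
  classical
  have hlim : Tendsto (fun t : Finset {x : C // x ∈ L ∧ x ≠ 0} => ∏ x ∈ t, (1 - z / (x : C))) atTop
      (𝓝 (∏' x : {x : C // x ∈ L ∧ x ≠ 0}, (1 - z / (x : C)))) := by
    simpa [HasProd] using (h.multipliable z).hasProd
  have hat : Tendsto (fun n => (s n).subtype fun x => x ∈ L ∧ x ≠ 0) atTop atTop := by
    refine tendsto_atTop.2 fun t => ?_
    have : ∀ᶠ n in atTop, ∀ x ∈ t, (x : C) ∈ s n :=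
      (eventually_all_finset t).2 fun x _ => hex x x.2.1 x.2.2
    filter_upwards [this] with n hn x hx
    exact Finset.mem_subtype.2 (hn x hx)
  refine (hlim.comp hat).congr fun n => ?_
  exact Finset.prod_subtype_of_mem (fun x => 1 - z / x) (hs n)

variable {W : AddSubgroup C}

omit [IsUltrametricDist C] [CompleteSpace C] in
theorem ball_zero_mem (h : FiniteBalls (W : Set C)) (n : ℕ) : 0 ∈ h.ball n :=
  h.mem_ball.2 ⟨W.zero_mem, by simp⟩

-- The ultrametric inequality makes the truncations of W finite groups, to which the additivity of
-- finite products applies.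
omit [CompleteSpace C] in
theorem ball_add_mem (h : FiniteBalls (W : Set C)) (n : ℕ) :
    ∀ x ∈ h.ball n, ∀ y ∈ h.ball n, x + y ∈ h.ball n := fun x hx y hy => by
  rw [h.mem_ball] at *
  exact ⟨W.add_mem hx.1 hy.1, (IsUltrametricDist.norm_add_le_max x y).trans (max_le hx.2 hy.2)⟩

omit [IsUltrametricDist C] [CompleteSpace C] in
theorem ball_neg_mem (h : FiniteBalls (W : Set C)) (n : ℕ) :
    ∀ x ∈ h.ball n, -x ∈ h.ball n := fun x hx => by
  rw [h.mem_ball] at *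
  exact ⟨W.neg_mem hx.1, by rw [norm_neg]; exact hx.2⟩

open Classical in
theorem tendsto_finExp_ball (h : FiniteBalls (W : Set C)) (z : C) :
    Tendsto (fun n => finExp (h.ball n) z) atTop (𝓝 (setExp (W : Set C) z)) := by
  refine (tendsto_prod_exhaustion h z (fun n => (h.ball n).erase 0) (fun n x hx => ?_)
    fun x hx hx0 => ?_).const_mul z
  · rw [Finset.mem_erase] at hx
    exact ⟨(h.mem_ball.1 hx.2).1, hx.1⟩
  · filter_upwards [h.eventually_mem_ball hx] with n hn
    exact Finset.mem_erase.2 ⟨hx0, hn⟩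

theorem setExp_add (h : FiniteBalls (W : Set C)) (x y : C) :
    setExp (W : Set C) (x + y) = setExp (W : Set C) x + setExp (W : Set C) y := by
  classical
  refine tendsto_nhds_unique (tendsto_finExp_ball h (x + y)) ?_
  refine ((tendsto_finExp_ball h x).add (tendsto_finExp_ball h y)).congr fun n => ?_
  exact (finExp_add _ (ball_zero_mem h n) (ball_add_mem h n) (ball_neg_mem h n) x y).symm

theorem setExp_eq_zero_iff (h : FiniteBalls (W : Set C)) {z : C} :
    setExp (W : Set C) z = 0 ↔ z ∈ W := by
  classical
  refine ⟨fun hz => by_contra fun hzW => ?_, fun hz => ?_⟩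
  · exact setExp_ne_zero h (fun h0 => hzW (by rw [h0]; exact W.zero_mem)) hzW hz
  · refine tendsto_nhds_unique (tendsto_finExp_ball h z) (tendsto_const_nhds.congr' ?_)
    filter_upwards [h.eventually_mem_ball hz] with n hn
    exact (finExp_eq_zero _ (ball_zero_mem h n) hn).symm

theorem setExp_neg (h : FiniteBalls (W : Set C)) (x : C) :
    setExp (W : Set C) (-x) = -setExp (W : Set C) x := by
  have := setExp_add h x (-x)
  rw [add_neg_cancel, (setExp_eq_zero_iff h).2 W.zero_mem] at this
  linear_combination -this

/-- The exponential function of a group in terms of that of a subgroup of finite index. -/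
theorem setExp_of_finiteIndex {V : AddSubgroup C} (hV : FiniteBalls (V : Set C)) (hWV : W ≤ V)
    (hW : FiniteBalls (W : Set C)) (R : Finset C) (hR : ∀ r ∈ R, r ∈ V ∧ r ∉ W)
    (hR' : ∀ x ∈ V, x ∉ W → ∃! r, r ∈ R ∧ x - r ∈ W) (z : C) :
    setExp (V : Set C) z = setExp (W : Set C) z *
      ∏ r ∈ R, (1 - setExp (W : Set C) z / setExp (W : Set C) r) := by
  classical
  -- V is exhausted not by its own balls but by the cosets r + (ball of W), so that the product over
  -- each stage factors exactly through `finExp` of the ball.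
  set s : ℕ → Finset C := fun n =>
    (hW.ball n).erase 0 ∪ R.biUnion fun r => (hW.ball n).image (r + ·) with hs
  have hnot : ∀ r ∈ R, ∀ w ∈ W, r + w ∉ W := fun r hr w hw h =>
    (hR r hr).2 (by simpa using W.sub_mem h hw)
  have hprod : ∀ n, z * ∏ x ∈ s n, (1 - z / x) =
      finExp (hW.ball n) z * ∏ r ∈ R, (1 - finExp (hW.ball n) z / finExp (hW.ball n) r) := by
    intro n
    rw [hs, Finset.prod_union, Finset.prod_biUnion, ← mul_assoc]
    · congr 1
      refine Finset.prod_congr rfl fun r hr => ?_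
      rw [Finset.prod_image fun x _ y _ hxy => add_left_cancel hxy]
      exact prod_coset _ (ball_zero_mem hW n) (ball_add_mem hW n) (ball_neg_mem hW n)
        (fun h => (hR r hr).2 (hW.mem_ball.1 h).1) z
    · intro r hr r' hr' hne
      refine Finset.disjoint_left.2 fun x hx hx' => hne ?_
      obtain ⟨w, hw, rfl⟩ := Finset.mem_image.1 hx
      obtain ⟨w', hw', h⟩ := Finset.mem_image.1 hx'
      have hwW : w ∈ W := (hW.mem_ball.1 hw).1
      have hwW' : w' ∈ W := (hW.mem_ball.1 hw').1
      refine (hR' (r + w) (V.add_mem (hR r hr).1 (hWV hwW)) (hnot r hr w hwW)).unique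
        ⟨hr, by simpa using hwW⟩ ⟨hr', ?_⟩
      rw [← h]
      simpa using hwW'
    · refine Finset.disjoint_left.2 fun x hx hx' => ?_
      obtain ⟨r, hr, hx'⟩ := Finset.mem_biUnion.1 hx'
      obtain ⟨w, hw, rfl⟩ := Finset.mem_image.1 hx'
      exact hnot r hr w (hW.mem_ball.1 hw).1 (hW.mem_ball.1 (Finset.mem_of_mem_erase hx)).1
  have h1 : Tendsto (fun n => z * ∏ x ∈ s n, (1 - z / x)) atTop (𝓝 (setExp (V : Set C) z)) := by
    refine (tendsto_prod_exhaustion hV z s (fun n x hx => ?_) fun x hx hx0 => ?_).const_mul z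
    · rcases Finset.mem_union.1 hx with hx | hx
      · rw [Finset.mem_erase] at hx
        exact ⟨hWV (hW.mem_ball.1 hx.2).1, hx.1⟩
      · obtain ⟨r, hr, hx⟩ := Finset.mem_biUnion.1 hx
        obtain ⟨w, hw, rfl⟩ := Finset.mem_image.1 hx
        have hwW : w ∈ W := (hW.mem_ball.1 hw).1
        exact ⟨V.add_mem (hR r hr).1 (hWV hwW), fun h => hnot r hr w hwW (h ▸ W.zero_mem)⟩
    · by_cases hxW : x ∈ W
      · filter_upwards [hW.eventually_mem_ball hxW] with n hn
        exact Finset.mem_union_left _ (Finset.mem_erase.2 ⟨hx0, hn⟩)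
      · obtain ⟨r, ⟨hr, hxr⟩, -⟩ := hR' x hx hxW
        filter_upwards [hW.eventually_mem_ball hxr] with n hn
        exact Finset.mem_union_right _ (Finset.mem_biUnion.2
          ⟨r, hr, Finset.mem_image.2 ⟨x - r, hn, by ring⟩⟩)
  refine tendsto_nhds_unique h1 (Tendsto.congr (fun n => (hprod n).symm) ?_)
  refine (tendsto_finExp_ball hW z).mul (tendsto_finsetProd _ fun r hr => ?_)
  exact tendsto_const_nhds.sub ((tendsto_finExp_ball hW z).div (tendsto_finExp_ball hW r)
    fun h => (hR r hr).2 ((setExp_eq_zero_iff hW).1 h))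

/-- The image under `exp_W` of `V`, in terms of representatives of the nonzero classes of `V`
modulo `W`. -/
theorem coe_insert_image_setExp [DecidableEq C] {V : AddSubgroup C}
    (hW : FiniteBalls (W : Set C)) (R : Finset C) (hR : ∀ r ∈ R, r ∈ V ∧ r ∉ W)
    (hR' : ∀ x ∈ V, x ∉ W → ∃! r, r ∈ R ∧ x - r ∈ W) :
    (↑(insert 0 (R.image (setExp (W : Set C)))) : Set C) = setExp (W : Set C) '' V := by
  ext y
  simp only [Finset.coe_insert, Finset.coe_image, Set.mem_insert_iff, Set.mem_image,
    Finset.mem_coe]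
  constructor
  · rintro (rfl | ⟨r, hr, rfl⟩)
    · exact ⟨0, V.zero_mem, (setExp_eq_zero_iff hW).2 W.zero_mem⟩
    · exact ⟨r, (hR r hr).1, rfl⟩
  · rintro ⟨x, hx, rfl⟩
    by_cases hxW : x ∈ W
    · exact Or.inl ((setExp_eq_zero_iff hW).2 hxW)
    · obtain ⟨r, ⟨hr, hxr⟩, -⟩ := hR' x hx hxW
      refine Or.inr ⟨r, hr, ?_⟩
      have := setExp_add hW (x - r) r
      rw [sub_add_cancel, (setExp_eq_zero_iff hW).2 hxr, zero_add] at this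
      exact this.symm

theorem setExp_injOn_reps {V : AddSubgroup C} (hW : FiniteBalls (W : Set C)) (R : Finset C)
    (hR : ∀ r ∈ R, r ∈ V ∧ r ∉ W) (hR' : ∀ x ∈ V, x ∉ W → ∃! r, r ∈ R ∧ x - r ∈ W) :
    Set.InjOn (setExp (W : Set C)) R := by
  intro r hr r' hr' h
  refine (hR' r (hR r hr).1 (hR r hr).2).unique ⟨hr, by simp⟩ ⟨hr', ?_⟩
  rw [← setExp_eq_zero_iff hW, sub_eq_add_neg, setExp_add hW, setExp_neg hW, h, add_neg_cancel]

/-- A product over the values `exp_W(r)` is a product over the nonzero elements of the finite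
group `exp_W(V)`. -/
theorem prod_reps_eq_finExp [DecidableEq C] {V : AddSubgroup C} (hW : FiniteBalls (W : Set C))
    (R : Finset C) (hR : ∀ r ∈ R, r ∈ V ∧ r ∉ W)
    (hR' : ∀ x ∈ V, x ∉ W → ∃! r, r ∈ R ∧ x - r ∈ W)
    {M : Type*} [CommMonoid M] (g : C → M) :
    ∏ r ∈ R, g (setExp (W : Set C) r) =
      ∏ s ∈ (insert 0 (R.image (setExp (W : Set C)))).erase 0, g s := by
  rw [Finset.erase_insert, Finset.prod_image (setExp_injOn_reps hW R hR hR')]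
  intro h
  obtain ⟨r, hr, h⟩ := Finset.mem_image.1 h
  exact (hR r hr).2 ((setExp_eq_zero_iff hW).1 h)

end Exponential


/-! ### Norms and coefficients of Laurent series -/

section Laurent

variable {F : Type*} [Field F] [Fintype F]

theorem one_lt_card_real : (1 : ℝ) < Fintype.card F := by exact_mod_cast Fintype.one_lt_card

omit [Fintype F] in
theorem algebraMap_kInf_eq (c : F) : algebraMap F (KInf F) c = HahnSeries.C c := by
  rw [HahnSeries.algebraMap_apply']
  exact HahnSeries.ofPowerSeries_C c

/-- Scalar multiplication of Laurent series is multiplication by a constant. -/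
theorem smul_kInf_eq (c : F) (x : KInf F) : c • x = algebraMap F (KInf F) c * x := by
  rw [algebraMap_kInf_eq, HahnSeries.C_mul_eq_smul]

omit [Fintype F] in
theorem T_zpow (n : ℤ) : T F ^ n = HahnSeries.single (-n) 1 := by
  rw [T, RatFunc.single_zpow (-1), RatFunc.single_zpow (-n), ← zpow_mul, neg_one_mul]

/-- The coefficient of index m belongs to T⁻ᵐ, so a small norm means vanishing in low index. -/
theorem norm_le_zpow_iff {x : KInf F} {n : ℤ} :
    ‖x‖ ≤ (Fintype.card F : ℝ) ^ (-n) ↔ ∀ m < n, x.coeff m = 0 := by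
  rw [← LaurentSeries.valuation_le_iff_coeff_lt_eq_zero, ← LaurentSeries.valuation_single_zpow F,
    ← Valued.toNormedField.norm_le_iff]
  have : ‖(HahnSeries.single n 1 : KInf F)‖ = (Fintype.card F : ℝ) ^ (-n) := by
    rw [← norm_T, ← norm_zpow, T_zpow, neg_neg]
  rw [← this]

theorem norm_eq_zpow_order {x : KInf F} (hx : x ≠ 0) :
    ‖x‖ = (Fintype.card F : ℝ) ^ (-x.order) := by
  have key : ∀ y : KInf F, ‖y‖ ≤ (Fintype.card F : ℝ) ^ (-y.order) := fun y =>
    norm_le_zpow_iff.2 fun m hm => HahnSeries.coeff_eq_zero_of_lt_order hm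
  refine le_antisymm (key x) ?_
  -- The lower bound for ‖x‖ is the upper bound applied to x⁻¹.
  have h1 : x.order + x⁻¹.order = 0 := by
    rw [← HahnSeries.order_mul hx (inv_ne_zero hx), mul_inv_cancel₀ hx, HahnSeries.order_one]
  have h := key x⁻¹
  rw [norm_inv, show -x⁻¹.order = x.order by omega] at h
  rw [zpow_neg]
  exact inv_le_of_inv_le₀ (norm_pos_iff.2 hx) h

theorem norm_algebraMap_unit {c : F} (hc : c ≠ 0) : ‖algebraMap F (KInf F) c‖ = 1 := by
  have hq : Fintype.card F - 1 ≠ 0 := by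
    have := Fintype.one_lt_card (α := F)
    omega
  rw [← pow_eq_one_iff_of_nonneg (norm_nonneg _) hq, ← norm_pow, ← map_pow,
    FiniteField.pow_card_sub_one_eq_one c hc, map_one, norm_one]

/-- The case distinction is needed because `toNat` sends every negative integer to 0 and would
return the constant term for n > 0. -/
theorem coeff_polyEmb (p : F[X]) (n : ℤ) :
    (polyEmb p).coeff n = if n ≤ 0 then p.coeff (-n).toNat else 0 := by
  have hT : ∀ i : ℕ, (T F ^ i).coeff n = if n = -(i : ℤ) then 1 else 0 := fun i => by
    rw [← zpow_natCast, T_zpow, HahnSeries.coeff_single]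
    congr
  rw [polyEmb, aeval_eq_sum_range, HahnSeries.coeff_sum]
  simp only [Algebra.smul_def, ← smul_kInf_eq, HahnSeries.coeff_smul, Algebra.algebraMap_self_apply, hT, mul_ite, mul_one, mul_zero]
  split_ifs with hn
  · by_cases h : (-n).toNat ≤ p.natDegree
    · rw [Finset.sum_eq_single (-n).toNat]
      · rw [if_pos (by omega)]
      · intro i _ hi
        rw [if_neg (by omega)]
      · intro hi
        exact absurd (Finset.mem_range.2 (by omega)) hi
    · rw [coeff_eq_zero_of_natDegree_lt (by omega)]
      refine Finset.sum_eq_zero fun i hi => ?_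
      rw [Finset.mem_range] at hi
      rw [if_neg (by omega)]
  · refine Finset.sum_eq_zero fun i _ => ?_
    rw [if_neg (by omega)]

theorem norm_polyEmb {p : F[X]} (hp : p ≠ 0) :
    ‖polyEmb p‖ = (Fintype.card F : ℝ) ^ p.natDegree := by
  have hc : (polyEmb p).coeff (-p.natDegree) ≠ 0 := by
    rw [coeff_polyEmb, if_pos (by omega)]
    simpa using hp
  have h0 : polyEmb p ≠ 0 := fun h => hc (by rw [h]; rfl)
  rw [← zpow_natCast]
  refine le_antisymm ?_ ?_
  · rw [← neg_neg (p.natDegree : ℤ)]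
    refine norm_le_zpow_iff.2 fun m hm => ?_
    rw [coeff_polyEmb, if_pos (by omega), coeff_eq_zero_of_natDegree_lt (by omega)]
  · rw [norm_eq_zpow_order h0]
    have := HahnSeries.order_le_of_coeff_ne_zero hc
    exact zpow_le_zpow_right₀ one_lt_card_real.le (by omega)

theorem finiteBalls_range_polyEmb : FiniteBalls (Set.range (polyEmb (F := F))) := by
  intro r
  obtain ⟨n, hn⟩ := pow_unbounded_of_one_lt r (one_lt_card_real (F := F))
  have hfin : Finite (degreeLT F (n + 1)) := Finite.of_equiv _ (degreeLTEquiv F (n + 1)).symm.toEquiv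
  refine (Set.Finite.image (polyEmb (F := F)) (Set.toFinite (degreeLT F (n + 1) : Set F[X]))).subset ?_
  rintro _ ⟨⟨p, rfl⟩, hp⟩
  refine ⟨p, ?_, rfl⟩
  by_cases h0 : p = 0
  · rw [h0]; exact Submodule.zero_mem _
  · rw [norm_polyEmb h0] at hp
    have := (pow_lt_pow_iff_right₀ (one_lt_card_real (F := F))).1 (hp.trans_lt hn)
    refine mem_degreeLT.2 ?_
    rw [degree_eq_natDegree h0]
    exact_mod_cast this.trans (Nat.lt_succ_self n)

/-- The coefficients of `T⁻¹, …, T⁻ⁿ`. -/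
def fracCoeff (F : Type*) [Field F] (n : ℕ) : KInf F →ₗ[F] (Fin n → F) :=
  LinearMap.pi fun i => HahnSeries.coeff.linearMap ((i : ℤ) + 1)

theorem exists_polyEmb_near {n : ℕ} {x : KInf F} (hx : fracCoeff F n x = 0) :
    ∃ p : F[X], ‖x - polyEmb p‖ ≤ ((Fintype.card F : ℝ) ^ n)⁻¹ := by
  -- The polynomial part of x: indices below the order contribute nothing. The hypothesis kills
  -- indices 1 to n; the bound claimed uses only those below n.
  refine ⟨∑ i ∈ Finset.range ((-x.order).toNat + 1), Polynomial.C (x.coeff (-(i : ℤ))) * X ^ i, ?_⟩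
  rw [← zpow_natCast, ← zpow_neg]
  refine norm_le_zpow_iff.2 fun m hm => ?_
  rw [HahnSeries.coeff_sub, coeff_polyEmb, finsetSum_coeff]
  simp only [coeff_C_mul, coeff_X_pow, mul_ite, mul_one, mul_zero]
  split_ifs with hm0
  · rw [Finset.sum_ite_eq]
    split_ifs with h
    · rw [show -((-m).toNat : ℤ) = m by omega, sub_self]
    · rw [Finset.mem_range] at h
      rw [sub_zero, HahnSeries.coeff_eq_zero_of_lt_order (by omega)]
  · have := congrFun hx ⟨(m - 1).toNat, by omega⟩
    change x.coeff (((m - 1).toNat : ℤ) + 1) = 0 at this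
    rw [show ((m - 1).toNat : ℤ) + 1 = m by omega] at this
    rw [this, sub_zero]

end Laurent

/-! ### Periods do not vanish -/

section Periods

variable {F : Type*} [Field F] [Fintype F]

/-- In a = (a - f) + f the second term strictly dominates. -/
theorem norm_of_isQuadraticUnit {a : F[X]} {b : F} {f : KInf F} (hf : IsQuadraticUnit a b f) :
    ‖f‖ = (Fintype.card F : ℝ) ^ a.natDegree := by
  rw [← norm_polyEmb hf.monic.ne_zero]
  have h := IsUltrametricDist.norm_add_eq_max_of_norm_ne_norm hf.conj_lt.ne
  rw [sub_add_cancel, max_eq_right hf.conj_lt.le] at h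
  exact h.symm

theorem norm_uniformizer {f π : KInf F} {d : ℕ} (hd : d ≠ 0)
    (hf : ‖f‖ = (Fintype.card F : ℝ) ^ d) (hπ : IsUniformizer f d π) :
    ‖π‖ = (Fintype.card F : ℝ)⁻¹ := by
  obtain ⟨-, h⟩ := hπ
  split_ifs at h
  · have := congrArg norm h
    rw [norm_pow, norm_inv, hf, ← inv_pow] at this
    exact (pow_left_inj₀ (norm_nonneg _) (by positivity) hd).1 this
  · have := congrArg norm h
    rw [norm_pow, norm_inv, norm_mul, hf, norm_T, ← pow_succ, ← inv_pow] at this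
    exact (pow_left_inj₀ (norm_nonneg _) (by positivity) d.succ_ne_zero).1 this

omit [Fintype F] in
theorem sgn_ne_zero {x : KInf F} (hx : x ≠ 0) : sgn x ≠ 0 := HahnSeries.leadingCoeff_ne_zero.2 hx

theorem norm_oneUnit {π x : KInf F} (hπ : ‖π‖ = (Fintype.card F : ℝ)⁻¹) (hx : x ≠ 0) :
    ‖oneUnit π x‖ = 1 := by
  have hq : (Fintype.card F : ℝ) ≠ 0 := by exact_mod_cast Fintype.card_ne_zero
  rw [oneUnit, norm_div, norm_mul, norm_algebraMap_unit (sgn_ne_zero hx), norm_zpow, hπ,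
    norm_eq_zpow_order hx, degT, div_one, inv_zpow, mul_inv_cancel₀ (zpow_ne_zero _ hq)]

/-- Every factor of ξ^(q-1) is nonzero: η is a product of signs, π has norm q⁻¹, and u is a limit of
elements of norm 1. -/
theorem IsPeriod.ne_zero {π : KInf F} {L : Set (KInf F)} {ξ : CInf F}
    (hπ : ‖π‖ = (Fintype.card F : ℝ)⁻¹) (h : IsPeriod π L ξ) : ξ ≠ 0 := by
  obtain ⟨η, t, u, hη, -, hu, h⟩ := h
  have hη0 : η ≠ 0 := by
    obtain ⟨M, hM⟩ := hη.exists
    rw [← hM]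
    -- `∏ᶠ` takes the value 1 on an infinite support, which the induction also covers, so no
    -- finiteness of the index set is needed.
    exact finprod_mem_induction (· ≠ 0) one_ne_zero (fun _ _ => mul_ne_zero)
      fun x hx => sgn_ne_zero hx.2.1
  have hu1 : ‖u‖ = 1 := by
    refine tendsto_nhds_unique hu.norm (tendsto_const_nhds.congr fun M => ?_)
    refine (finprod_mem_induction (fun y : KInf F => ‖y‖ = 1) norm_one
      (fun x y hx hy => by rw [norm_mul, hx, hy, one_mul]) fun x hx => norm_oneUnit hπ hx.2.1).symm
  have hu0 : u ≠ 0 := norm_ne_zero_iff.1 (by rw [hu1]; exact one_ne_zero)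
  have hπ0 : π ≠ 0 := norm_ne_zero_iff.1 (by rw [hπ]; simp)
  rintro rfl
  have hq : Fintype.card F - 1 ≠ 0 := by
    have := Fintype.one_lt_card (α := F)
    omega
  rw [zero_pow hq, eq_comm, map_eq_zero] at h
  refine mul_ne_zero (mul_ne_zero (inv_ne_zero ?_) (zpow_ne_zero _ hπ0)) (pow_ne_zero _ hu0) h
  exact (_root_.map_ne_zero _).2 hη0

end Periods


/-! ### Submodules of elements close to a given submodule -/

section Near

variable {F E : Type*} [Field F] [NormedAddCommGroup E] [Module F E]

theorem infDist_submodule_lt_iff {S : Submodule F E} {r : ℝ} {x : E} :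
    Metric.infDist x (S : Set E) < r ↔ ∃ y ∈ S, ‖x - y‖ < r := by
  rw [Metric.infDist_lt_iff ⟨0, S.zero_mem⟩]
  simp only [dist_eq_norm, SetLike.mem_coe]

variable [IsUltrametricDist E] in
/-- The elements at distance less than `r` from `S`. -/
def nearSubmodule (hsmul : ∀ (c : F) (x : E), ‖c • x‖ ≤ ‖x‖) (S : Submodule F E) {r : ℝ}
    (hr : 0 < r) : Submodule F E where
  carrier := {x | Metric.infDist x (S : Set E) < r}
  zero_mem' := infDist_submodule_lt_iff.2 ⟨0, S.zero_mem, by simpa using hr⟩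
  add_mem' := by
    intro x y hx hy
    obtain ⟨x', hx', hx⟩ := infDist_submodule_lt_iff.1 hx
    obtain ⟨y', hy', hy⟩ := infDist_submodule_lt_iff.1 hy
    refine infDist_submodule_lt_iff.2 ⟨x' + y', S.add_mem hx' hy', ?_⟩
    rw [add_sub_add_comm]
    exact (IsUltrametricDist.norm_add_le_max _ _).trans_lt (max_lt hx hy)
  smul_mem' := by
    intro c x hx
    obtain ⟨x', hx', hx⟩ := infDist_submodule_lt_iff.1 hx
    refine infDist_submodule_lt_iff.2 ⟨c • x', S.smul_mem c hx', ?_⟩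
    rw [← smul_sub]
    exact (hsmul c _).trans_lt hx

end Near

section Spaces

variable {F : Type*} [Field F] [Fintype F]

instance cInfUltra : IsUltrametricDist (CInf F) := IsUltrametricDist.of_normedAlgebra (KInf F)

theorem norm_algebraMap_cInf (x : KInf F) : ‖algebraMap (KInf F) (CInf F) x‖ = ‖x‖ :=
  norm_algebraMap' _ x

theorem smul_cInf_eq (c : F) (z : CInf F) :
    c • z = algebraMap (KInf F) (CInf F) (algebraMap F (KInf F) c) * z := by
  rw [Algebra.smul_def]
  rfl

theorem norm_smul_kInf_le (c : F) (x : KInf F) : ‖c • x‖ ≤ ‖x‖ := by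
  by_cases hc : c = 0
  · rw [hc, zero_smul, norm_zero]
    exact norm_nonneg _
  · rw [smul_kInf_eq, norm_mul, norm_algebraMap_unit hc, one_mul]

theorem norm_smul_cInf_le (c : F) (x : CInf F) : ‖c • x‖ ≤ ‖x‖ := by
  by_cases hc : c = 0
  · rw [hc, zero_smul, norm_zero]
    exact norm_nonneg _
  · rw [smul_cInf_eq, norm_mul, norm_algebraMap_cInf, norm_algebraMap_unit hc, one_mul]

/-- The ring `A` as a subspace of `k_∞`. -/
def polySubmodule (F : Type*) [Field F] [Fintype F] : Submodule F (KInf F) :=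
  { (polyEmb (F := F)).range.toSubring.toAddSubgroup with
    smul_mem' := by
      rintro c _ ⟨p, rfl⟩
      have h : polyEmb (c • p) = c • polyEmb p := by
        rw [smul_kInf_eq, Polynomial.smul_eq_C_mul, map_mul]
        congr 1
        exact aeval_C _ c
      exact ⟨c • p, h⟩ }

/-- Multiplication by `c` on `k_∞`. -/
def mulMap (c : KInf F) : KInf F →ₗ[F] KInf F where
  toFun x := x * c
  map_add' x y := add_mul x y c
  map_smul' a x := by rw [RingHom.id_apply, smul_kInf_eq, smul_kInf_eq, mul_assoc]

/-- `Λ_ε(f)` as a subspace of `k_∞`. -/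
def lamSubmodule (f : KInf F) {ε : ℝ} (hε : 0 < ε) : Submodule F (KInf F) :=
  polySubmodule F ⊓
    (nearSubmodule norm_smul_kInf_le (polySubmodule F) hε).comap (mulMap f)

/-- Multiplication by `c` from `k_∞` to `C_∞`. -/
def scale (c : CInf F) : KInf F →ₗ[F] CInf F where
  toFun x := c * algebraMap (KInf F) (CInf F) x
  map_add' x y := by rw [map_add, mul_add]
  map_smul' a x := by
    rw [RingHom.id_apply, smul_cInf_eq, smul_kInf_eq, map_mul]
    ring

/-- `Λ̆_ε(f)` as a subspace of `C_∞`. -/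
def breveSubmodule (f : KInf F) {ε : ℝ} (hε : 0 < ε) (ξ : CInf F) : Submodule F (CInf F) :=
  (lamSubmodule f hε).map (scale ξ)

theorem coe_breveSubmodule (f : KInf F) {ε : ℝ} (hε : 0 < ε) (ξ : CInf F) :
    (breveSubmodule f hε ξ : Set (CInf F)) = breveLam f ε ξ := by
  ext x
  exact ⟨fun ⟨y, hy, h⟩ => ⟨y, hy, h.symm⟩, fun ⟨y, hy, h⟩ => ⟨y, hy, h.symm⟩⟩

/-- `α⁻¹ Λ̆_ε(f)` as a subspace of `C_∞`. -/
def invMulSubmodule (f : KInf F) {ε : ℝ} (hε : 0 < ε) (ξ : CInf F) (α : KInf F) :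
    Submodule F (CInf F) :=
  (lamSubmodule f hε).map (scale ((algebraMap (KInf F) (CInf F) α)⁻¹ * ξ))

theorem coe_invMulSubmodule (f : KInf F) {ε : ℝ} (hε : 0 < ε) (ξ : CInf F) (α : KInf F) :
    (invMulSubmodule f hε ξ α : Set (CInf F)) = invMul α (breveLam f ε ξ) := by
  ext x
  constructor
  · rintro ⟨y, hy, rfl⟩
    exact ⟨_, ⟨y, hy, rfl⟩, mul_assoc _ _ _⟩
  · rintro ⟨_, ⟨y, hy, rfl⟩, rfl⟩
    exact ⟨y, hy, mul_assoc _ _ _⟩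

/-- `Λ̃_{ε,α}(f)` as a subspace of `C_∞`. -/
def tildeSubmodule (f : KInf F) {ε : ℝ} (hε : 0 < ε) (ξ : CInf F) (α : KInf F) {δ : ℝ}
    (hδ : 0 < δ) : Submodule F (CInf F) :=
  invMulSubmodule f hε ξ α ⊓ nearSubmodule norm_smul_cInf_le (breveSubmodule f hε ξ) hδ

theorem coe_tildeSubmodule (f : KInf F) {ε : ℝ} (hε : 0 < ε) (ξ : CInf F) (α : KInf F) {δ : ℝ}
    (hδ : 0 < δ) :
    (tildeSubmodule f hε ξ α hδ : Set (CInf F)) = tildeLam α (breveLam f ε ξ) δ := by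
  ext x
  change x ∈ (invMulSubmodule f hε ξ α : Set (CInf F)) ∧
    Metric.infDist x (breveSubmodule f hε ξ : Set (CInf F)) < δ ↔
      x ∈ invMul α (breveLam f ε ξ) ∧ Metric.infDist x (breveLam f ε ξ) < δ
  rw [coe_invMulSubmodule, coe_breveSubmodule]

theorem finiteBalls_map_scale (f : KInf F) {ε : ℝ} (hε : 0 < ε) {c : CInf F} (hc : c ≠ 0) :
    FiniteBalls ((lamSubmodule f hε).map (scale c) : Set (CInf F)) := by
  intro r
  refine ((finiteBalls_range_polyEmb (F := F) (r / ‖c‖)).image (scale c)).subset ?_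
  rintro _ ⟨⟨y, hy, rfl⟩, hr⟩
  refine ⟨y, ⟨hy.1, ?_⟩, rfl⟩
  rw [le_div_iff₀ (norm_pos_iff.2 hc), mul_comm, ← norm_algebraMap_cInf y, ← norm_mul]
  exact hr

/-- If `α⁻¹ y` and `f α⁻¹ y` have enough vanishing coefficients, then `α⁻¹ y` is close to an
element of `Λ_ε(f)`. -/
theorem exists_lam_near (f : KInf F) {ε δ : ℝ} (hε : 0 < ε) (hδ : 0 < δ) :
    ∃ n : ℕ, ∀ x : KInf F, fracCoeff F n x = 0 → fracCoeff F n (x * f) = 0 →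
      ∃ y ∈ lamSubmodule f hε, ‖x - y‖ < δ := by
  -- With p and p' the polynomial parts of x and xf, the bound δ makes p close to x, while ε/(‖f‖ +
  -- 1) and ε control the two terms of pf - p' = -(x - p)f + (xf - p').
  set e := min δ (min ε (ε / (‖f‖ + 1))) with he
  have he0 : 0 < e := by positivity
  obtain ⟨n, hn⟩ := pow_unbounded_of_one_lt e⁻¹ (one_lt_card_real (F := F))
  have hne : ((Fintype.card F : ℝ) ^ n)⁻¹ < e := inv_lt_of_inv_lt₀ he0 hn
  refine ⟨n, fun x hx hxf => ?_⟩
  obtain ⟨p, hp⟩ := exists_polyEmb_near hx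
  obtain ⟨p', hp'⟩ := exists_polyEmb_near hxf
  refine ⟨polyEmb p, ⟨⟨p, rfl⟩, ?_⟩, (hp.trans_lt hne).trans_le (min_le_left _ _)⟩
  refine infDist_submodule_lt_iff.2 ⟨polyEmb p', ⟨p', rfl⟩, ?_⟩
  rw [show mulMap f (polyEmb p) = polyEmb p * f from rfl,
    show polyEmb p * f - polyEmb p' = -((x - polyEmb p) * f) + (x * f - polyEmb p') by ring]
  refine (IsUltrametricDist.norm_add_le_max _ _).trans_lt (max_lt ?_ ?_)
  · rw [norm_neg, norm_mul]
    have h1 : ‖x - polyEmb p‖ ≤ ε / (‖f‖ + 1) :=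
      (hp.trans hne.le).trans ((min_le_right _ _).trans (min_le_right _ _))
    rw [le_div_iff₀ (by positivity)] at h1
    by_cases h0 : ‖x - polyEmb p‖ = 0
    · rw [h0, zero_mul]
      exact hε
    · have : 0 < ‖x - polyEmb p‖ := lt_of_le_of_ne (norm_nonneg _) (Ne.symm h0)
      linarith
  · exact (hp'.trans_lt hne).trans_le ((min_le_right _ _).trans (min_le_left _ _))

/-- The quotient `α⁻¹ Λ̆ / Λ̃` is finite-dimensional. By compactness of `k_∞ / A` this holds for every
`α ∈ k_∞` and every `δ > 0`. -/
theorem finite_quotient (f : KInf F) {ε : ℝ} (hε : 0 < ε) {ξ : CInf F} (hξ : ξ ≠ 0) (α : KInf F)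
    {δ : ℝ} (hδ : 0 < δ) :
    Module.Finite F (invMulSubmodule f hε ξ α ⧸
      (tildeSubmodule f hε ξ α hδ).submoduleOf (invMulSubmodule f hε ξ α)) := by
  have hξ0 : 0 < ‖ξ‖ := norm_pos_iff.2 hξ
  obtain ⟨n, hn⟩ := exists_lam_near f hε (div_pos hδ hξ0)
  let V := invMulSubmodule f hε ξ α
  let W := tildeSubmodule f hε ξ α hδ
  let m : lamSubmodule f hε →ₗ[F] V :=
    ((scale ((algebraMap (KInf F) (CInf F) α)⁻¹ * ξ)).domRestrict _).codRestrict V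
      fun y => ⟨y, y.2, rfl⟩
  have hm : Function.Surjective m := by
    rintro ⟨_, y, hy, rfl⟩
    exact ⟨⟨y, hy⟩, rfl⟩
  let g : lamSubmodule f hε →ₗ[F] V ⧸ W.submoduleOf V := (W.submoduleOf V).mkQ ∘ₗ m
  have hg : Function.Surjective g := (Submodule.mkQ_surjective _).comp hm
  -- Elements of ker k map into Λ̃, so the quotient by ker k, of dimension at most 2n, surjects onto
  -- V/W.
  let k : lamSubmodule f hε →ₗ[F] (Fin n → F) × (Fin n → F) :=
    ((fracCoeff F n ∘ₗ mulMap α⁻¹).prod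
      (fracCoeff F n ∘ₗ mulMap f ∘ₗ mulMap α⁻¹)).domRestrict _
  have hk : LinearMap.ker k ≤ LinearMap.ker g := by
    intro y hy
    have hy := Prod.ext_iff.1 (LinearMap.mem_ker.1 hy)
    obtain ⟨y', hy', hlt⟩ := hn (y * α⁻¹) hy.1 hy.2
    rw [LinearMap.mem_ker]
    refine (Submodule.Quotient.mk_eq_zero _).2 ⟨(m y).2, ?_⟩
    refine infDist_submodule_lt_iff.2 ⟨scale ξ y', ⟨y', hy', rfl⟩, ?_⟩
    have : (m y : CInf F) - scale ξ y' = ξ * algebraMap (KInf F) (CInf F) (y * α⁻¹ - y') := by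
      change (algebraMap (KInf F) (CInf F) α)⁻¹ * ξ * algebraMap (KInf F) (CInf F) y -
        ξ * algebraMap (KInf F) (CInf F) y' = _
      rw [map_sub, map_mul, map_inv₀]
      ring
    change ‖(m y : CInf F) - scale ξ y'‖ < δ
    rw [this, norm_mul, norm_algebraMap_cInf, mul_comm]
    exact (lt_div_iff₀ hξ0).1 hlt
  have hfin : Module.Finite F (lamSubmodule f hε ⧸ LinearMap.ker k) :=
    Module.Finite.equiv k.quotKerEquivRange.symm
  refine Module.Finite.of_surjective ((LinearMap.ker k).liftQ g hk) fun x => ?_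
  obtain ⟨y, rfl⟩ := hg x
  exact ⟨Submodule.Quotient.mk y, rfl⟩

theorem exists_isNonzeroReps (V W : Submodule F (CInf F)) [Module.Finite F (V ⧸ W.submoduleOf V)] :
    ∃ R, IsNonzeroReps V W R := by
  classical
  have hfin : Finite (V ⧸ W.submoduleOf V) := Module.finite_of_finite F
  have := Fintype.ofFinite (V ⧸ W.submoduleOf V)
  let o : V ⧸ W.submoduleOf V → CInf F := fun c => (c.out : V)
  have hmk : ∀ (c : V ⧸ W.submoduleOf V) (x : V),
      Submodule.Quotient.mk x = c ↔ (x : CInf F) - o c ∈ W := fun c x => by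
    conv_lhs => rw [← Quotient.out_eq c]
    exact Submodule.Quotient.eq _
  refine ⟨(Finset.univ.erase 0).image o, fun r hr => ?_, fun x hx hxW => ?_⟩
  · obtain ⟨c, hc, rfl⟩ := Finset.mem_image.1 hr
    refine ⟨c.out.2, fun h => Finset.ne_of_mem_erase hc ?_⟩
    -- A chosen representative lying in W would force its class to be zero.
    rw [← (hmk c 0).2 (by rw [ZeroMemClass.coe_zero, zero_sub]; exact W.neg_mem h)]
    rfl
  · refine ⟨o (Submodule.Quotient.mk ⟨x, hx⟩), ⟨Finset.mem_image.2 ⟨_, ?_, rfl⟩, ?_⟩, ?_⟩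
    · refine Finset.mem_erase.2 ⟨fun h => hxW ?_, Finset.mem_univ _⟩
      exact (Submodule.Quotient.mk_eq_zero (W.submoduleOf V)).1 h
    · exact (hmk _ ⟨x, hx⟩).1 rfl
    · rintro r ⟨hr, hxr⟩
      obtain ⟨c, hc, rfl⟩ := Finset.mem_image.1 hr
      rw [(hmk c ⟨x, hx⟩).2 hxr]

end Spaces

/-! ### The polynomial `ρ` -/

section Rho

variable {F : Type*} [Field F] [Fintype F]

open Classical in
/-- The polynomial `α w ∏_{0 ≠ s ∈ S} (1 - w / s)`. -/
def finExpPoly (α : KInf F) (S : Finset (CInf F)) : (CInf F)[X] :=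
  Polynomial.C (algebraMap (KInf F) (CInf F) α) * X *
    ∏ s ∈ S.erase 0, (1 - Polynomial.C s⁻¹ * X)

open Classical in
theorem eval_finExpPoly (α : KInf F) (S : Finset (CInf F)) (z : CInf F) :
    (finExpPoly α S).eval z = algebraMap (KInf F) (CInf F) α * finExp S z := by
  simp only [finExpPoly, finExp, eval_mul, eval_C, eval_X, eval_prod, eval_sub, eval_one,
    div_eq_inv_mul, mul_assoc]

theorem eval_rhoPoly (α : KInf F) (W : Set (CInf F)) (R : Finset (CInf F)) (z : CInf F) :
    (rhoPoly α W R).eval z = algebraMap (KInf F) (CInf F) α * z *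
      ∏ r ∈ R, (1 - z / latticeExp W r) := by
  simp only [rhoPoly, eval_mul, eval_C, eval_X, eval_prod, eval_sub, eval_one, div_eq_inv_mul]

variable {V W : Submodule F (CInf F)}

-- Exhibits ρ through R only by way of the finite set exp_W(V); independence of R and additivity
-- both follow from this.
open Classical in
theorem rhoPoly_eq_finExpPoly (hW : FiniteBalls (W : Set (CInf F))) {R : Finset (CInf F)}
    (hR : IsNonzeroReps V W R) (α : KInf F) :
    rhoPoly α (W : Set (CInf F)) R =
      finExpPoly α (insert 0 (R.image (setExp (W : Set (CInf F))))) := by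
  rw [rhoPoly, finExpPoly]
  congr 1
  exact prod_reps_eq_finExp (V := V.toAddSubgroup) (W := W.toAddSubgroup) hW R hR.1 hR.2
    fun s => 1 - Polynomial.C s⁻¹ * X

theorem rhoPoly_congr (hW : FiniteBalls (W : Set (CInf F))) {R R' : Finset (CInf F)}
    (hR : IsNonzeroReps V W R) (hR' : IsNonzeroReps V W R') (α : KInf F) :
    rhoPoly α (W : Set (CInf F)) R = rhoPoly α (W : Set (CInf F)) R' := by
  classical
  rw [rhoPoly_eq_finExpPoly hW hR, rhoPoly_eq_finExpPoly hW hR']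
  congr 1
  refine Finset.coe_injective ?_
  exact (coe_insert_image_setExp (V := V.toAddSubgroup) (W := W.toAddSubgroup) hW R hR.1
    hR.2).trans (coe_insert_image_setExp (V := V.toAddSubgroup) (W := W.toAddSubgroup) hW R' hR'.1
    hR'.2).symm

theorem eval_rhoPoly_add (hW : FiniteBalls (W : Set (CInf F))) {R : Finset (CInf F)}
    (hR : IsNonzeroReps V W R) (α : KInf F) (x y : CInf F) :
    (rhoPoly α (W : Set (CInf F)) R).eval (x + y) =
      (rhoPoly α (W : Set (CInf F)) R).eval x + (rhoPoly α (W : Set (CInf F)) R).eval y := by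
  classical
  have hmem : ∀ s, s ∈ insert 0 (R.image (setExp (W : Set (CInf F)))) ↔
      s ∈ setExp (W : Set (CInf F)) '' V := fun s => by
    rw [← Finset.mem_coe]
    exact Set.ext_iff.1 (coe_insert_image_setExp (V := V.toAddSubgroup) (W := W.toAddSubgroup) hW R
      hR.1 hR.2) s
  rw [rhoPoly_eq_finExpPoly hW hR, eval_finExpPoly, eval_finExpPoly, eval_finExpPoly, finExp_add,
    mul_add]
  · exact Finset.mem_insert_self _ _
  · intro s hs t ht
    rw [hmem] at *
    obtain ⟨v, hv, rfl⟩ := hs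
    obtain ⟨w, hw, rfl⟩ := ht
    exact ⟨v + w, V.add_mem hv hw, setExp_add (W := W.toAddSubgroup) hW v w⟩
  · intro s hs
    rw [hmem] at *
    obtain ⟨v, hv, rfl⟩ := hs
    exact ⟨-v, V.neg_mem hv, setExp_neg (W := W.toAddSubgroup) hW v⟩

end Rho

end QuantumDrinfeld

end

/-! ### Factorization of e_ε(αz) and the polynomial ρ -/

theorem mainTheorem8 {F : Type*} [Field F] [Fintype F]
    (a : F[X]) (b : F) (f : QuantumDrinfeld.KInf F) (hf : QuantumDrinfeld.IsQuadraticUnit a b f)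
    (π : QuantumDrinfeld.KInf F) (hπ : QuantumDrinfeld.IsUniformizer f a.natDegree π)
    (N l : ℕ) (hl : l < a.natDegree)
    (ε : ℝ) (hε : ε = QuantumDrinfeld.epsNl F a.natDegree N l)
    (ξ : QuantumDrinfeld.CInf F)
    (hξ : QuantumDrinfeld.IsPeriod π (QuantumDrinfeld.Lam f ε) ξ)
    (ξ' : QuantumDrinfeld.CInf F)
    (hξ' : QuantumDrinfeld.IsPeriod π (QuantumDrinfeld.idealA f (a.natDegree - 1 - l)) ξ')
    (δ : ℝ) (hδ : δ = ((Fintype.card F : ℝ) ^ (a.natDegree * N))⁻¹ * ε * ‖ξ'‖)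
    (α : QuantumDrinfeld.KInf F) (hα : α ∈ QuantumDrinfeld.AInf1 f) (hα0 : α ≠ 0)
    (hδα : δ < ‖α‖⁻¹) :
    ∃ V W : Submodule F (QuantumDrinfeld.CInf F),
      (V : Set (QuantumDrinfeld.CInf F)) =
        QuantumDrinfeld.invMul α (QuantumDrinfeld.breveLam f ε ξ) ∧
      (W : Set (QuantumDrinfeld.CInf F)) =
        QuantumDrinfeld.tildeLam α (QuantumDrinfeld.breveLam f ε ξ) δ ∧
      Module.Finite F (V ⧸ W.submoduleOf V) ∧
      (∀ z, Multipliable (QuantumDrinfeld.expFactor (QuantumDrinfeld.breveLam f ε ξ) z)) ∧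
      (∀ z, Multipliable (QuantumDrinfeld.expFactor (W : Set (QuantumDrinfeld.CInf F)) z)) ∧
      (∃ R, QuantumDrinfeld.IsNonzeroReps V W R) ∧
      (∀ R, QuantumDrinfeld.IsNonzeroReps V W R →
        (∀ r ∈ R, QuantumDrinfeld.latticeExp (W : Set (QuantumDrinfeld.CInf F)) r ≠ 0) ∧
        ∀ z : QuantumDrinfeld.CInf F,
          QuantumDrinfeld.latticeExp (QuantumDrinfeld.breveLam f ε ξ)
              (algebraMap (QuantumDrinfeld.KInf F) (QuantumDrinfeld.CInf F) α * z) =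
            algebraMap (QuantumDrinfeld.KInf F) (QuantumDrinfeld.CInf F) α *
              QuantumDrinfeld.latticeExp (W : Set (QuantumDrinfeld.CInf F)) z *
              ∏ r ∈ R, (1 - QuantumDrinfeld.latticeExp (W : Set (QuantumDrinfeld.CInf F)) z /
                QuantumDrinfeld.latticeExp (W : Set (QuantumDrinfeld.CInf F)) r)) ∧
      ∃ ρ : (QuantumDrinfeld.CInf F)[X],
        (∀ x y, ρ.eval (x + y) = ρ.eval x + ρ.eval y) ∧
        (∀ R, QuantumDrinfeld.IsNonzeroReps V W R →
          ρ = QuantumDrinfeld.rhoPoly α (W : Set (QuantumDrinfeld.CInf F)) R) ∧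
        ∀ z : QuantumDrinfeld.CInf F,
          QuantumDrinfeld.latticeExp (QuantumDrinfeld.breveLam f ε ξ)
              (algebraMap (QuantumDrinfeld.KInf F) (QuantumDrinfeld.CInf F) α * z) =
            ρ.eval (QuantumDrinfeld.latticeExp (W : Set (QuantumDrinfeld.CInf F)) z) := by
  classical
  have hd : a.natDegree ≠ 0 := by omega
  have hπn := QuantumDrinfeld.norm_uniformizer hd (QuantumDrinfeld.norm_of_isQuadraticUnit hf) hπ
  have hξ0 : ξ ≠ 0 := hξ.ne_zero hπn
  have hq : (0 : ℝ) < Fintype.card F := by exact_mod_cast Fintype.card_pos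
  have hε0 : 0 < ε := by
    rw [hε, QuantumDrinfeld.epsNl]
    positivity
  have hδ0 : 0 < δ := by
    rw [hδ]
    have := norm_pos_iff.2 (hξ'.ne_zero hπn)
    positivity
  have hc : algebraMap (QuantumDrinfeld.KInf F) (QuantumDrinfeld.CInf F) α ≠ 0 :=
    (_root_.map_ne_zero _).2 hα0
  set V := QuantumDrinfeld.invMulSubmodule f hε0 ξ α with hV
  set W := QuantumDrinfeld.tildeSubmodule f hε0 ξ α hδ0 with hW
  have hWV : W ≤ V := inf_le_left
  have hVb : QuantumDrinfeld.FiniteBalls (V : Set (QuantumDrinfeld.CInf F)) :=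
    QuantumDrinfeld.finiteBalls_map_scale f hε0 (mul_ne_zero (inv_ne_zero hc) hξ0)
  have hWb : QuantumDrinfeld.FiniteBalls (W : Set (QuantumDrinfeld.CInf F)) := hVb.mono hWV
  have hLb : QuantumDrinfeld.FiniteBalls (QuantumDrinfeld.breveLam f ε ξ) := by
    rw [← QuantumDrinfeld.coe_breveSubmodule f hε0 ξ]
    exact QuantumDrinfeld.finiteBalls_map_scale f hε0 hξ0
  have hfin : Module.Finite F (V ⧸ W.submoduleOf V) :=
    QuantumDrinfeld.finite_quotient f hε0 hξ0 α hδ0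
  have hVW : ∀ R, QuantumDrinfeld.IsNonzeroReps V W R → ∀ z : QuantumDrinfeld.CInf F,
      QuantumDrinfeld.latticeExp (QuantumDrinfeld.breveLam f ε ξ)
          (algebraMap (QuantumDrinfeld.KInf F) (QuantumDrinfeld.CInf F) α * z) =
        algebraMap (QuantumDrinfeld.KInf F) (QuantumDrinfeld.CInf F) α *
          QuantumDrinfeld.latticeExp (W : Set (QuantumDrinfeld.CInf F)) z *
          ∏ r ∈ R, (1 - QuantumDrinfeld.latticeExp (W : Set (QuantumDrinfeld.CInf F)) z /
            QuantumDrinfeld.latticeExp (W : Set (QuantumDrinfeld.CInf F)) r) := by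
    intro R hR z
    have h1 := QuantumDrinfeld.setExp_mul_left (QuantumDrinfeld.breveLam f ε ξ) hc z
    have h2 := QuantumDrinfeld.setExp_of_finiteIndex (V := V.toAddSubgroup)
      (W := W.toAddSubgroup) hVb hWV hWb R hR.1 hR.2 z
    rw [mul_assoc]
    -- `latticeExp` and `setExp` unfold to the same product. After rescaling by α, only the
    -- identification of α⁻¹Λ̆ with the carrier of V remains.
    refine h1.trans (congrArg _ (Eq.trans ?_ h2))
    exact congrArg (QuantumDrinfeld.setExp · z)
      (QuantumDrinfeld.coe_invMulSubmodule f hε0 ξ α).symm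
  obtain ⟨R₀, hR₀⟩ := QuantumDrinfeld.exists_isNonzeroReps V W
  refine ⟨V, W, QuantumDrinfeld.coe_invMulSubmodule f hε0 ξ α,
    QuantumDrinfeld.coe_tildeSubmodule f hε0 ξ α hδ0, hfin, hLb.multipliable, hWb.multipliable,
    ⟨R₀, hR₀⟩, fun R hR => ⟨fun r hr h => (hR.1 r hr).2 ?_, hVW R hR⟩,
    QuantumDrinfeld.rhoPoly α W R₀, QuantumDrinfeld.eval_rhoPoly_add hWb hR₀ α,
    fun R hR => QuantumDrinfeld.rhoPoly_congr hWb hR₀ hR α, fun z => ?_⟩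
  · exact (QuantumDrinfeld.setExp_eq_zero_iff (W := W.toAddSubgroup) hWb).1 h
  · rw [QuantumDrinfeld.eval_rhoPoly, hVW R₀ hR₀ z]
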